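/- Let $k$ be a commutative noetherian ring. Let $\mathcal C$ be the category whose objects are the finite sets and whose morphisms from $X$ to $Y$ are the subsets of $Y\times X$ (correspondences), with composition $RS=\{(z,x) : \exists\, y,\ (z,y)\in R,\ (y,x)\in S\}$. Let $k\mathcal C$ be its $k$-linearization, and write $k\mathcal C(Y,X)$ for the free $k$-module on the set of correspondences from $X$ to $Y$. A correspondence functor over $k$ is a $k$-linear functor from $k\mathcal C$ to the category of $k$-modules. For $\varphi\in k\mathcal C(Y,X)$ and $m\in M(X)$ write $\varphi\cdot m=M(\varphi)(m)$. We say that $M$ is generated by $M(E)$ if, for every finite set $X$, $M(X)$ is spanned by the elements $\varphi\cdot m$ with $\varphi\in k\mathcal C(X,E)$ and $m\in M(E)$. For a finite set $F$ and a left $k\mathcal C(F,F)$-module $W$, let $L_{F,W}=k\mathcal C(-,F)\otimes_{k\mathcal C(F,F)}W$. Let $J_{F,W}$ be the subfunctor of $L_{F,W}$ defined by $$J_{F,W}(X)=\Big\{\sum_i\varphi_i\otimes w_i\in L_{F,W}(X)\ \Big|\ \forall\,\psi\in k\mathcal C(F,X),\ \sum_i(\psi\varphi_i)\cdot w_i=0\Big\},$$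 and let $S_{F,W}=L_{F,W}/J_{F,W}$. For a correspondence functor $M$, the counit morphism $\eta_{M,F}:L_{F,M(F)}\to M$ is given by $\varphi\otimes m\mapsto\varphi\cdot m$. Theorem. Let $M$ be a correspondence functor over $k$ which is generated by $M(E)$ for some finite set $E$. (a) For any finite set $F$ such that $|F|\ge 2^{|E|}$, the counit morphism $\eta_{M,F}:L_{F,M(F)}\to M$ is an isomorphism. (b) For any finite set $G$ such that $|G|\ge 2^{2^{|E|}}$, we have $M\cong L_{G,M(G)}$ and $J_{G,M(G)}=0$, hence $M\cong S_{G,M(G)}$. -/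

import Mathlib

open CategoryTheory
open scoped TensorProduct

universe u v u₁ v₁

/-! ### Finite sets and correspondences -/

/-- The finite sets, as objects of the category of finite sets and correspondences. -/
structure FinCorr : Type (v + 1) where
  carrier : Type v
  [finite : Finite carrier]

namespace FinCorr

/-- A morphism from `X` to `Y` is a subset of `Y × X`; for `S ⊆ Y × X` and `R ⊆ Z × Y` the
composite `S ≫ R` is `R S`, the set of all `(z, x)` such that `(z, y) ∈ R` and `(y, x) ∈ S` for
some `y`. -/
instance category : Category.{v} FinCorr.{v} where
  Hom X Y := Set (Y.carrier × X.carrier)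
  id X := {p | p.1 = p.2}
  comp {X Y Z} S R :=
    {p : Z.carrier × X.carrier | ∃ y : Y.carrier, (p.1, y) ∈ R ∧ (y, p.2) ∈ S}
  id_comp S := by
    ext ⟨a, b⟩
    simp
  comp_id S := by
    ext ⟨a, b⟩
    simp
  assoc S R T := by
    ext ⟨a, b⟩
    constructor
    · rintro ⟨z, hz, y, hy, hx⟩
      exact ⟨y, ⟨z, hz, hy⟩, hx⟩
    · rintro ⟨y, ⟨z, hz, hy⟩, hx⟩
      exact ⟨z, hz, y, hy, hx⟩

end FinCorr

/-- The `k`-linearization of the category of finite sets and correspondences: the same objects,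
and the free `k`-module on the set of correspondences from `X` to `Y` as morphisms. -/
abbrev LinCorr (k : Type u) := CategoryTheory.Free k FinCorr.{v}

/-- A finite set as an object of the linearized category of correspondences. -/
def LinCorr.of (k : Type u) (E : Type v) [Finite E] : LinCorr.{u, v} k :=
  CategoryTheory.Free.of k (FinCorr.mk E)

/-! ### Representations of a linear category

Here `D` is a `k`-linear category, and a representation of `D` is a `k`-linear functor from `D`
to `k`-modules. In `End X` the product is `f * g = g ≫ f`, so that `End X` acts on the left on the
evaluation at `X` of a functor. -/

namespace LinRep

section Evaluation

variable {k : Type u} [CommRing k] {D : Type u₁} [Category.{v₁} D] [Preadditive D]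
  (M : D ⥤ ModuleCat.{v₁} k)

/-- The evaluation `M(X)` as an `End X`-module. -/
instance evalModule [M.Additive] (X : D) : Module (End X) (M.obj X) where
  smul f m := (M.map (X := X) (Y := X) f).hom m
  one_smul m := by
    change (M.map (𝟙 X)).hom m = m
    simp
  mul_smul f g m := by
    change (M.map ((show X ⟶ X from g) ≫ (show X ⟶ X from f))).hom m = _
    rw [M.map_comp]
    rfl
  smul_zero f := map_zero _
  smul_add f := map_add _
  add_smul f g m := by
    change (M.map (X := X) (Y := X) (f + g)).hom m = _
    rw [M.map_add]
    rfl
  zero_smul m := by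
    change (M.map (0 : X ⟶ X)).hom m = 0
    simp

theorem eval_smul_def [M.Additive] {X : D} (f : End X) (m : M.obj X) :
    f • m = (M.map (X := X) (Y := X) f).hom m := rfl

instance evalScalarTower [Linear k D] [M.Additive] [M.Linear k] (X : D) :
    IsScalarTower k (End X) (M.obj X) where
  smul_assoc r f m := by
    change (M.map (r • (show X ⟶ X from f))).hom m = r • (M.map (X := X) (Y := X) f).hom m
    rw [M.map_smul]
    rfl

/-- `M` is generated by `M(X)`: every element of `M(Y)` is a finite sum of elements `φ · m`,
where `φ` is a morphism from `X` to `Y` and `m ∈ M(X)`. -/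
def IsGeneratedAt (X : D) : Prop :=
  ∀ Y : D, Submodule.span k {y : M.obj Y | ∃ (φ : X ⟶ Y) (m : M.obj X), (M.map φ).hom m = y} = ⊤

end Evaluation

section Induced

variable (k : Type u) [CommRing k] {D : Type u₁} [Category.{v₁} D] [Preadditive D] [Linear k D]
  (X : D) (W : Type v₁) [AddCommGroup W] [Module k W] [Module (End X) W]

/-- The relations which define the tensor product of the right `End X`-module `D(Y, X)`, the
module of morphisms from `X` to `Y`, with the left `End X`-module `W`, as a quotient of their
tensor product over `k`. -/
def tensorRel (Y : D) : Submodule k ((X ⟶ Y) ⊗[k] W) :=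
  Submodule.span k {t | ∃ (φ : X ⟶ Y) (ρ : X ⟶ X) (w : W),
    t = (ρ ≫ φ) ⊗ₜ[k] w - φ ⊗ₜ[k] ((show End X from ρ) • w)}

theorem tensorRel_le_comap {Y Z : D} (ψ : Y ⟶ Z) :
    tensorRel k X W Y ≤
      (tensorRel k X W Z).comap (LinearMap.rTensor W (Linear.rightComp k X ψ)) := by
  refine Submodule.span_le.2 ?_
  rintro _ ⟨φ, ρ, w, rfl⟩
  refine Submodule.subset_span ⟨φ ≫ ψ, ρ, w, ?_⟩
  simp

/-- The functor `L_{X,W}`, whose value at `Y` is the tensor product over `End X` of the module of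
morphisms from `X` to `Y` with `W`. -/
noncomputable def L : D ⥤ ModuleCat.{v₁} k where
  obj Y := ModuleCat.of k (((X ⟶ Y) ⊗[k] W) ⧸ tensorRel k X W Y)
  map ψ := ModuleCat.ofHom (Submodule.mapQ _ _ _ (tensorRel_le_comap k X W ψ))
  map_id Y := by
    refine ModuleCat.hom_ext (Submodule.linearMap_qext _ (TensorProduct.ext' fun φ w => ?_))
    change Submodule.Quotient.mk ((φ ≫ 𝟙 Y) ⊗ₜ[k] w) = Submodule.Quotient.mk (φ ⊗ₜ[k] w)
    rw [Category.comp_id]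
  map_comp f g := by
    refine ModuleCat.hom_ext (Submodule.linearMap_qext _ (TensorProduct.ext' fun φ w => ?_))
    change Submodule.Quotient.mk ((φ ≫ f ≫ g) ⊗ₜ[k] w) =
      Submodule.Quotient.mk (((φ ≫ f) ≫ g) ⊗ₜ[k] w)
    rw [Category.assoc]

/-- The element `φ ⊗ w` of `L_{X,W}(Y)`. -/
noncomputable def L.tmul {Y : D} (φ : X ⟶ Y) (w : W) : (L k X W).obj Y :=
  Submodule.Quotient.mk (p := tensorRel k X W Y) (φ ⊗ₜ[k] w)

theorem L.map_tmul {Y Z : D} (ψ : Y ⟶ Z) (φ : X ⟶ Y) (w : W) :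
    ((L k X W).map ψ).hom (L.tmul k X W φ w) = L.tmul k X W (φ ≫ ψ) w := rfl

variable {k X W} in
theorem L.induction {Y : D} {P : (L k X W).obj Y → Prop} (t : (L k X W).obj Y)
    (zero : P 0) (tmul : ∀ φ w, P (L.tmul k X W φ w)) (add : ∀ a b, P a → P b → P (a + b)) :
    P t := by
  obtain ⟨t, rfl⟩ := Submodule.Quotient.mk_surjective (tensorRel k X W Y) t
  induction t using TensorProduct.induction_on with
  | zero => exact zero
  | add a b ha hb => exact add _ _ ha hb
  | tmul φ w => exact tmul φ w

instance L.additive : (L k X W).Additive where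
  map_add {Y Z f g} := by
    ext t
    induction t using L.induction with
    | zero => simp
    | add a b ha hb => rw [map_add, ha, hb, map_add]
    | tmul φ w =>
      rw [ModuleCat.hom_add, LinearMap.add_apply]
      simp only [L.map_tmul]
      rw [Preadditive.comp_add, L.tmul, TensorProduct.add_tmul]
      rfl

instance L.linear : (L k X W).Linear k where
  map_smul {Y Z} f r := by
    ext t
    induction t using L.induction with
    | zero => simp
    | add a b ha hb => rw [map_add, ha, hb, map_add]
    | tmul φ w =>
      rw [ModuleCat.hom_smul, LinearMap.smul_apply]
      simp only [L.map_tmul]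
      rw [Linear.comp_smul, L.tmul, ← TensorProduct.smul_tmul']
      rfl

variable [IsScalarTower k (End X) W]

/-- The `k`-bilinear action of `End X` on `W`. -/
def actBilin : (X ⟶ X) →ₗ[k] W →ₗ[k] W :=
  LinearMap.mk₂ k (fun ρ w => (show End X from ρ) • w)
    (fun ρ σ w => add_smul (show End X from ρ) (show End X from σ) w)
    (fun r ρ w => smul_assoc r (show End X from ρ) w)
    (fun ρ w w' => smul_add (show End X from ρ) w w')
    (fun r ρ w => by
      have := IsScalarTower.to_smulCommClass (R := k) (A := End X) (M := W)
      exact smul_comm (show End X from ρ) r w)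

/-- For a morphism `ψ` from `Y` to `X`, the map from `L_{X,W}(Y)` to `W` which sends
`φ ⊗ w` to `(ψ φ) · w`. -/
noncomputable def L.ev {Y : D} (ψ : Y ⟶ X) : (L k X W).obj Y →ₗ[k] W :=
  Submodule.liftQ (tensorRel k X W Y)
    (TensorProduct.lift ((actBilin k X W).comp (Linear.rightComp k X ψ))) (by
      refine Submodule.span_le.2 ?_
      rintro _ ⟨φ, ρ, w, rfl⟩
      rw [SetLike.mem_coe, LinearMap.mem_ker, map_sub, sub_eq_zero]
      change (show End X from (ρ ≫ φ) ≫ ψ) • w =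
        (show End X from φ ≫ ψ) • ((show End X from ρ) • w)
      rw [smul_smul, Category.assoc]
      rfl)

theorem L.ev_tmul {Y : D} (ψ : Y ⟶ X) (φ : X ⟶ Y) (w : W) :
    L.ev k X W ψ (L.tmul k X W φ w) = (show End X from φ ≫ ψ) • w := rfl

/-- The submodule `J_{X,W}(Y)` of `L_{X,W}(Y)`: the elements `∑ φ_i ⊗ w_i` such that
`∑ (ψ φ_i) · w_i = 0` for all morphisms `ψ` from `Y` to `X`. -/
noncomputable def J (Y : D) : Submodule k ((L k X W).obj Y) where
  carrier := {t | ∀ ψ : Y ⟶ X, L.ev k X W ψ t = 0}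
  zero_mem' ψ := map_zero _
  add_mem' ha hb ψ := by rw [map_add, ha ψ, hb ψ, add_zero]
  smul_mem' r t ht ψ := by rw [map_smul, ht ψ, smul_zero]

theorem J_le_comap {Y Z : D} (χ : Y ⟶ Z) :
    J k X W Y ≤ (J k X W Z).comap ((L k X W).map χ).hom := by
  intro t ht ψ
  have key : ∀ t : (L k X W).obj Y,
      L.ev k X W ψ (((L k X W).map χ).hom t) = L.ev k X W (χ ≫ ψ) t := by
    intro t
    induction t using L.induction with
    | zero => simp
    | add a b ha hb => rw [map_add, map_add, ha, hb, map_add]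
    | tmul φ w => rw [L.map_tmul, L.ev_tmul, L.ev_tmul, Category.assoc]
  rw [key]
  exact ht _

/-- The quotient functor `S_{X,W} = L_{X,W} / J_{X,W}`. -/
noncomputable def S : D ⥤ ModuleCat.{v₁} k where
  obj Y := ModuleCat.of k ((L k X W).obj Y ⧸ J k X W Y)
  map χ := ModuleCat.ofHom (Submodule.mapQ _ _ _ (J_le_comap k X W χ))
  map_id Y := by
    refine ModuleCat.hom_ext (Submodule.linearMap_qext _ (LinearMap.ext fun t => ?_))
    change Submodule.Quotient.mk (((L k X W).map (𝟙 Y)).hom t) = Submodule.Quotient.mk t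
    rw [CategoryTheory.Functor.map_id]
    rfl
  map_comp f g := by
    refine ModuleCat.hom_ext (Submodule.linearMap_qext _ (LinearMap.ext fun t => ?_))
    change Submodule.Quotient.mk (((L k X W).map (f ≫ g)).hom t) =
      Submodule.Quotient.mk (((L k X W).map g).hom (((L k X W).map f).hom t))
    rw [Functor.map_comp]
    rfl

instance S.additive : (S k X W).Additive where
  map_add {Y Z f g} := by
    refine ModuleCat.hom_ext (Submodule.linearMap_qext _ (LinearMap.ext fun t => ?_))
    change Submodule.Quotient.mk (((L k X W).map (f + g)).hom t) =
      Submodule.Quotient.mk (((L k X W).map f).hom t + ((L k X W).map g).hom t)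
    rw [Functor.map_add]
    rfl

instance S.linear : (S k X W).Linear k where
  map_smul {Y Z} f r := by
    refine ModuleCat.hom_ext (Submodule.linearMap_qext _ (LinearMap.ext fun t => ?_))
    change Submodule.Quotient.mk (((L k X W).map (r • f)).hom t) =
      Submodule.Quotient.mk (r • ((L k X W).map f).hom t)
    rw [Functor.map_smul]
    rfl

end Induced

section Counit

variable {k : Type u} [CommRing k] {D : Type u₁} [Category.{v₁} D] [Preadditive D] [Linear k D]
  (M : D ⥤ ModuleCat.{v₁} k) [M.Additive] [M.Linear k] (X : D)

/-- The component at `Y` of the counit: `φ ⊗ m ↦ φ · m`. -/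
noncomputable def counitApp (Y : D) : (L k X (M.obj X)).obj Y →ₗ[k] M.obj Y :=
  Submodule.liftQ (tensorRel k X (M.obj X) Y)
    (TensorProduct.lift (LinearMap.mk₂ k (fun (φ : X ⟶ Y) (m : M.obj X) => (M.map φ).hom m)
      (fun φ φ' m => by rw [M.map_add]; rfl)
      (fun r φ m => by rw [M.map_smul]; rfl)
      (fun φ m m' => map_add _ _ _)
      (fun r φ m => map_smul _ _ _))) (by
      refine Submodule.span_le.2 ?_
      rintro _ ⟨φ, ρ, m, rfl⟩
      rw [SetLike.mem_coe, LinearMap.mem_ker, map_sub, sub_eq_zero]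
      change (M.map (ρ ≫ φ)).hom m = (M.map φ).hom ((M.map ρ).hom m)
      rw [M.map_comp]
      rfl)

theorem counitApp_tmul {Y : D} (φ : X ⟶ Y) (m : M.obj X) :
    counitApp M X Y (L.tmul k X (M.obj X) φ m) = (M.map φ).hom m := rfl

/-- The counit morphism from `L_{X,M(X)}` to `M`, which corresponds to the identity of `M(X)`
under the adjunction between `W ↦ L_{X,W}` and the evaluation at `X`. -/
noncomputable def counit : L k X (M.obj X) ⟶ M where
  app Y := ModuleCat.ofHom (counitApp M X Y)
  naturality Y Z ψ := by
    ext t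
    change counitApp M X Z (((L k X (M.obj X)).map ψ).hom t) = (M.map ψ).hom (counitApp M X Y t)
    induction t using L.induction with
    | zero => simp
    | add a b ha hb => rw [map_add, map_add, ha, hb, map_add, map_add]
    | tmul φ m =>
      rw [L.map_tmul, counitApp_tmul, counitApp_tmul, M.map_comp]
      rfl

end Counit

end LinRep

/-! The identity of `Y` need not factor linearly through `F`, but on morphisms out of `E` it agrees
with some `u` that does. If `M` is generated at `E`, such a `u` acts as the identity on `M(Y)`. The
functor `L_{F,M(F)}` is again generated at `E`, so `u` also fixes its elements. Bijectivity of the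
counit and the vanishing of `J` then only need checking on composites `Y ⟶ F ⟶ Y`.

To build `u` for correspondences, take for each `R : E ⟶ X` the equivalence relation on `X`
identifying points with equal fibres. It fixes `R`, enlarges every other correspondence, and has at
most `2 ^ |E|` classes, so it factors through `F`. Multiplying the complements `1 - e` along the
inclusion order gives `1 - u` (`exists_mem_factorSpan`). -/

namespace LinRep

/-! ### Consequences of local units in a linear category -/

section LocalUnits

variable {k : Type u} [CommRing k] {D : Type u₁} [Category.{v₁} D] [Preadditive D] [Linear k D]

variable (k) in
/-- The endomorphisms of `Y` which are linear combinations of morphisms factoring through `F`. -/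
def factorSpan (F Y : D) : Submodule k (Y ⟶ Y) :=
  Submodule.span k {f | ∃ (a : Y ⟶ F) (b : F ⟶ Y), a ≫ b = f}

theorem comp_mem_factorSpan {F Y : D} {u : Y ⟶ Y} (hu : u ∈ factorSpan k F Y) (v : Y ⟶ Y) :
    v ≫ u ∈ factorSpan k F Y := by
  induction hu using Submodule.span_induction with
  | mem f hf =>
    obtain ⟨a, b, rfl⟩ := hf
    exact Submodule.subset_span ⟨v ≫ a, b, Category.assoc _ _ _⟩
  | zero => simp
  | add f g _ _ hf hg => rw [Preadditive.comp_add]; exact add_mem hf hg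
  | smul r f _ hf => rw [Linear.comp_smul]; exact Submodule.smul_mem _ _ hf

variable (k) in
/-- Morphisms out of `E` are fixed by endomorphisms that factor linearly through `F`. -/
def HasLocalUnits (E F : D) : Prop :=
  ∀ Y : D, ∃ u ∈ factorSpan k F Y, ∀ φ : E ⟶ Y, φ ≫ u = φ

variable {M : D ⥤ ModuleCat.{v₁} k}

omit [Preadditive D] [Linear k D] in
theorem IsGeneratedAt.map_eq_self {E Y : D} (hM : IsGeneratedAt M E) {u : Y ⟶ Y}
    (hu : ∀ φ : E ⟶ Y, φ ≫ u = φ) (y : M.obj Y) : (M.map u).hom y = y := by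
  have hy : y ∈ (⊤ : Submodule k (M.obj Y)) := trivial
  rw [← hM Y] at hy
  induction hy using Submodule.span_induction with
  | mem y hy =>
    obtain ⟨φ, m, rfl⟩ := hy
    rw [← LinearMap.comp_apply, ← ModuleCat.hom_comp, ← M.map_comp, hu]
  | zero => simp
  | add x y _ _ hx hy => rw [map_add, hx, hy]
  | smul r x _ hx => rw [map_smul, hx]

variable [M.Additive] [M.Linear k]

/-- With `u` fixing `y`, this reduces `y ∈ N` to composites through `F`. The choices of `N` below
give vanishing, surjectivity and generation. -/
theorem map_mem_of_mem_factorSpan {F Y : D} {u : Y ⟶ Y} (hu : u ∈ factorSpan k F Y)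
    (y : M.obj Y) (N : Submodule k (M.obj Y))
    (hN : ∀ (a : Y ⟶ F) (b : F ⟶ Y), (M.map b).hom ((M.map a).hom y) ∈ N) :
    (M.map u).hom y ∈ N := by
  induction hu using Submodule.span_induction with
  | mem f hf =>
    obtain ⟨a, b, rfl⟩ := hf
    rw [M.map_comp]
    exact hN a b
  | zero => simp
  | add f g _ _ hf hg => rw [M.map_add]; exact add_mem hf hg
  | smul r f _ hf => rw [M.map_smul]; exact Submodule.smul_mem _ _ hf

/-- An element which is killed by all morphisms to `F` is zero. -/
theorem eq_zero_of_map_eq_zero {E F Y : D} (hM : IsGeneratedAt M E)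
    (hEF : HasLocalUnits k E F) (y : M.obj Y)
    (hy : ∀ a : Y ⟶ F, (M.map a).hom y = 0) : y = 0 := by
  obtain ⟨u, hu, hfix⟩ := hEF Y
  have h := map_mem_of_mem_factorSpan (M := M) hu y ⊥ fun a b => by simp [hy a]
  rwa [hM.map_eq_self hfix, Submodule.mem_bot] at h

omit [M.Linear k] in
theorem tmul_comp (F : D) {Y : D} (ρ : F ⟶ F) (φ : F ⟶ Y) (m : M.obj F) :
    L.tmul k F (M.obj F) (ρ ≫ φ) m = L.tmul k F (M.obj F) φ ((M.map ρ).hom m) :=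
  (Submodule.Quotient.eq _).2 (Submodule.subset_span ⟨φ, ρ, m, rfl⟩)

variable (k M) in
/-- The linear map `m ↦ φ ⊗ m`. -/
noncomputable def tmulLinear {F Y : D} (φ : F ⟶ Y) :
    M.obj F →ₗ[k] (L k F (M.obj F)).obj Y :=
  (tensorRel k F (M.obj F) Y).mkQ ∘ₗ TensorProduct.mk k _ _ φ

omit [M.Linear k] in
theorem tmulLinear_apply {F Y : D} (φ : F ⟶ Y) (m : M.obj F) :
    tmulLinear k M φ m = L.tmul k F (M.obj F) φ m := rfl

theorem isGeneratedAt_L {E F : D} (hM : IsGeneratedAt M E) (hEF : HasLocalUnits k E F) :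
    IsGeneratedAt (L k F (M.obj F)) E := by
  intro Y
  set N := Submodule.span k {y : (L k F (M.obj F)).obj Y |
    ∃ (φ : E ⟶ Y) (m : (L k F (M.obj F)).obj E), ((L k F (M.obj F)).map φ).hom m = y}
  refine eq_top_iff.2 fun t _ => ?_
  obtain ⟨u, hu, hfix⟩ := hEF E
  induction t using L.induction with
  | zero => exact zero_mem N
  | add a b ha hb => exact add_mem (ha trivial) (hb trivial)
  | tmul φ m =>
    have hle : (⊤ : Submodule k (M.obj F)) ≤ N.comap (tmulLinear k M φ) := by
      rw [← hM F]
      refine Submodule.span_le.2 ?_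
      rintro _ ⟨χ, e, rfl⟩
      -- Expand `e` into terms `b · (a · e)` through `F`. Then `φ ⊗ (χ b a · e) = (φ χ b) ⊗ (a · e)`
      -- is the image under `φ χ : E ⟶ Y` of `b ⊗ (a · e)`.
      have h := map_mem_of_mem_factorSpan (M := M) hu e
        ((N.comap (tmulLinear k M φ)).comap (M.map χ).hom) fun a b => by
          rw [Submodule.mem_comap, Submodule.mem_comap, tmulLinear_apply]
          have : (M.map χ).hom ((M.map b).hom ((M.map a).hom e)) =
              (M.map (b ≫ χ)).hom ((M.map a).hom e) := by rw [M.map_comp]; rfl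
          rw [this, ← tmul_comp, Category.assoc, ← L.map_tmul k F (M.obj F) (χ ≫ φ) b]
          exact Submodule.subset_span ⟨_, _, rfl⟩
      rwa [hM.map_eq_self hfix] at h
    exact hle (show m ∈ ⊤ from trivial)

theorem map_counitApp {F Y Z : D} (f : Y ⟶ Z) (t : (L k F (M.obj F)).obj Y) :
    counitApp M F Z (((L k F (M.obj F)).map f).hom t) = (M.map f).hom (counitApp M F Y t) :=
  LinearMap.congr_fun (congrArg ModuleCat.Hom.hom ((counit M F).naturality f)) t

/-- After applying `a`, each `φ ⊗ m` has an endomorphism of `F` on the left, which moves across the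
tensor sign. So the composite depends on `t` only through its image under the counit. -/
theorem map_map_eq_tmul {F Y : D} (a : Y ⟶ F) (b : F ⟶ Y) (t : (L k F (M.obj F)).obj Y) :
    ((L k F (M.obj F)).map b).hom (((L k F (M.obj F)).map a).hom t) =
      L.tmul k F (M.obj F) b ((M.map a).hom (counitApp M F Y t)) := by
  rw [← tmulLinear_apply]
  induction t using L.induction with
  | zero => simp
  | add x y hx hy => simp only [map_add, hx, hy]
  | tmul φ m =>
    rw [L.map_tmul, L.map_tmul, counitApp_tmul, tmul_comp, tmulLinear_apply, M.map_comp]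
    rfl

theorem counitApp_injective {E F : D} (hM : IsGeneratedAt M E) (hEF : HasLocalUnits k E F)
    (Y : D) : Function.Injective (counitApp M F Y) := by
  refine (injective_iff_map_eq_zero _).2 fun t ht => ?_
  obtain ⟨u, hu, hfix⟩ := hEF Y
  have h := map_mem_of_mem_factorSpan (M := L k F (M.obj F)) hu t ⊥ fun a b => by
    rw [map_map_eq_tmul, ht, map_zero, ← tmulLinear_apply, map_zero]
    exact zero_mem _
  rwa [(isGeneratedAt_L hM hEF).map_eq_self hfix, Submodule.mem_bot] at h

theorem counitApp_surjective {E F : D} (hM : IsGeneratedAt M E) (hEF : HasLocalUnits k E F)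
    (Y : D) : Function.Surjective (counitApp M F Y) := by
  intro y
  obtain ⟨u, hu, hfix⟩ := hEF Y
  have h := map_mem_of_mem_factorSpan (M := M) hu y (LinearMap.range (counitApp M F Y))
    fun a b => ⟨L.tmul k F (M.obj F) b ((M.map a).hom y), counitApp_tmul _ _ _ _⟩
  rwa [hM.map_eq_self hfix] at h

theorem isIso_counit {E F : D} (hM : IsGeneratedAt M E) (hEF : HasLocalUnits k E F) :
    IsIso (counit M F) := by
  have (Y : D) : IsIso ((counit M F).app Y) :=
    (ConcreteCategory.isIso_iff_bijective _).2
      ⟨counitApp_injective hM hEF Y, counitApp_surjective hM hEF Y⟩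
  exact NatIso.isIso_of_isIso_app _

theorem ev_eq_map_counitApp {F Y : D} (ψ : Y ⟶ F) (t : (L k F (M.obj F)).obj Y) :
    L.ev k F (M.obj F) ψ t = (M.map ψ).hom (counitApp M F Y t) := by
  induction t using L.induction with
  | zero => simp
  | add x y hx hy => simp only [map_add, hx, hy]
  | tmul φ m =>
    rw [L.ev_tmul, counitApp_tmul, eval_smul_def, M.map_comp]
    rfl

/-- By `ev_eq_map_counitApp`, lying in `J` means that the counit image is killed by every morphism
to `F`. -/
theorem J_eq_bot {E F : D} (hM : IsGeneratedAt M E) (hEF : HasLocalUnits k E F) (Y : D) :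
    J k F (M.obj F) Y = ⊥ := by
  refine (Submodule.eq_bot_iff _).2 fun t ht => counitApp_injective hM hEF Y ?_
  rw [map_zero]
  refine eq_zero_of_map_eq_zero hM hEF _ fun a => ?_
  rw [← ev_eq_map_counitApp]
  exact ht a

/-- If `J_{X,W}` vanishes, then `L_{X,W}` is isomorphic to `S_{X,W}`. -/
noncomputable def isoS (X : D) (W : Type v₁) [AddCommGroup W] [Module k W] [Module (End X) W]
    [IsScalarTower k (End X) W] (h : ∀ Y, J k X W Y = ⊥) : L k X W ≅ S k X W :=
  NatIso.ofComponents
    (fun Y => ((Submodule.quotEquivOfEqBot _ (h Y)).symm.toModuleIso :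
      (L k X W).obj Y ≅ (S k X W).obj Y))
    (fun _ => rfl)

end LocalUnits

end LinRep

/-! ### Local units for correspondences -/

namespace FinCorr

variable (k : Type u) [CommRing k]

/-- The correspondence `{(y, x) | f y = f x}`. -/
def fiberRel (X : FinCorr.{v}) {T : Type*} (f : X.carrier → T) : X ⟶ X :=
  {p : X.carrier × X.carrier | f p.1 = f p.2}

/-- A correspondence from `E` to `X`, as a map from `X` to the power set of `E`. -/
def fiber {E X : FinCorr.{v}} (R : E ⟶ X) (x : X.carrier) : Set E.carrier :=
  {e | (x, e) ∈ (show Set (X.carrier × E.carrier) from R)}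

theorem comp_fiberRel_self {E X : FinCorr.{v}} (R : E ⟶ X) : R ≫ fiberRel X (fiber R) = R := by
  apply Set.ext
  rintro ⟨x, e⟩
  constructor
  · rintro ⟨y, hxy, hy⟩
    have h : fiber R x = fiber R y := hxy
    have : e ∈ fiber R y := hy
    rwa [← h] at this
  · exact fun h => ⟨x, rfl, h⟩

theorem subset_comp_fiberRel {E X : FinCorr.{v}} {T : Type*} (R : E ⟶ X) (f : X.carrier → T) :
    (show Set (X.carrier × E.carrier) from R) ⊆
      (show Set (X.carrier × E.carrier) from R ≫ fiberRel X f) :=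
  fun p hp => ⟨p.1, rfl, hp⟩

/-- Pass through the graph of `j ∘ f` and back along its opposite; injectivity of `j` ensures that
no further points are identified. -/
theorem exists_comp_eq_fiberRel {X F : FinCorr.{v}} {T : Type*} (f : X.carrier → T)
    (j : T ↪ F.carrier) : ∃ (a : X ⟶ F) (b : F ⟶ X), a ≫ b = fiberRel X f := by
  refine ⟨{p : F.carrier × X.carrier | p.1 = j (f p.2)},
    {p : X.carrier × F.carrier | p.2 = j (f p.1)}, ?_⟩
  apply Set.ext
  rintro ⟨x, y⟩
  constructor
  · rintro ⟨z, hx, hy⟩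
    exact j.injective (hx.symm.trans hy)
  · exact fun h => ⟨j (f x), rfl, congrArg j h⟩

/-- A correspondence as a morphism of the linearized category. -/
noncomputable def lin {X Y : FinCorr.{v}} (R : X ⟶ Y) : Free.of k X ⟶ Free.of k Y :=
  (Free.embedding k FinCorr.{v}).map R

theorem lin_comp {X Y Z : FinCorr.{v}} (R : X ⟶ Y) (S : Y ⟶ Z) :
    lin k (R ≫ S) = lin k R ≫ lin k S :=
  (Free.embedding k FinCorr.{v}).map_comp R S

/-- On an upper set of correspondences out of `E`, the identity of `X` agrees with a linear
combination of endomorphisms which factor through `F`. -/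
theorem exists_mem_factorSpan {E X F : FinCorr.{v}} (j : Set E.carrier ↪ F.carrier)
    (U : Set (Set (X.carrier × E.carrier))) (hfin : U.Finite) (hU : IsUpperSet U) :
    ∃ u ∈ LinRep.factorSpan k (Free.of k F) (Free.of k X),
      ∀ R : E ⟶ X, (show Set (X.carrier × E.carrier) from R) ∈ U →
        lin k R ≫ u = lin k R := by
  induction hn : U.ncard generalizing U with
  | zero =>
    rw [Set.ncard_eq_zero hfin] at hn
    subst hn
    exact ⟨0, zero_mem _, fun R hR => hR.elim⟩
  | succ n ih =>
    have hne : U.Nonempty := by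
      rw [← Set.ncard_pos hfin]; omega
    obtain ⟨R₀, hR₀⟩ := hfin.exists_minimal hne
    obtain ⟨u, hu, hfix⟩ := ih (U \ {R₀}) hfin.sdiff (by
      intro A B hAB hA
      refine ⟨hU hAB hA.1, fun hB => hA.2 ?_⟩
      obtain rfl : B = R₀ := hB
      exact le_antisymm hAB (hR₀.le_of_le hA.1 hAB)) (by
      rw [Set.ncard_sdiff_singleton_of_mem hR₀.prop, hn, Nat.add_sub_cancel])
    set e : X ⟶ X := fiberRel X (fiber (show E ⟶ X from R₀)) with he
    -- Chosen so that `1 - u' = (1 - e) ≫ (1 - u)`: `e` handles `R₀`, and `u` handles the rest of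
    -- `U`.
    refine ⟨lin k e + u - lin k e ≫ u, sub_mem (add_mem ?_ hu)
      (LinRep.comp_mem_factorSpan hu _), fun R hR => ?_⟩
    · obtain ⟨a, b, hab⟩ := exists_comp_eq_fiberRel (F := F) (fiber (show E ⟶ X from R₀)) j
      refine Submodule.subset_span ⟨lin k a, lin k b, ?_⟩
      rw [← lin_comp, hab]
    · rw [Preadditive.comp_sub, Preadditive.comp_add, ← Category.assoc, ← lin_comp]
      by_cases h : R = (show E ⟶ X from R₀)
      · subst h
        rw [he, comp_fiberRel_self]
        abel
      · have h1 := subset_comp_fiberRel R (fiber (show E ⟶ X from R₀))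
        -- `R ≫ e` contains `R`, so it stays in `U`. It cannot be `R₀`, since then `R ⊆ R₀` and
        -- minimality would give `R = R₀`. Hence `u` fixes both `R` and `R ≫ e`.
        rw [hfix R ⟨hR, h⟩, hfix (R ≫ e) ⟨hU h1 hR, fun h2 => h ?_⟩]
        · abel
        · have h3 : (show Set (X.carrier × E.carrier) from R ≫ e) = R₀ := h2
          rw [h3] at h1
          exact Set.Subset.antisymm h1 (hR₀.le_of_le hR h1)

theorem hasLocalUnits {E F : FinCorr.{v}} (h : 2 ^ Nat.card E.carrier ≤ Nat.card F.carrier) :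
    LinRep.HasLocalUnits k (Free.of k E) (Free.of k F) := by
  intro X
  change FinCorr.{v} at X
  have := E.finite
  have := F.finite
  have := X.finite
  obtain ⟨j⟩ : Nonempty (Set E.carrier ↪ F.carrier) := by
    have := Fintype.ofFinite E.carrier
    have := Fintype.ofFinite F.carrier
    refine Function.Embedding.nonempty_of_card_le ?_
    rwa [Fintype.card_set, ← Nat.card_eq_fintype_card, ← Nat.card_eq_fintype_card]
  obtain ⟨u, hu, hfix⟩ := exists_mem_factorSpan (X := X) k j Set.univ Set.finite_univ isUpperSet_univ
  refine ⟨u, hu, fun φ => ?_⟩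
  change (E ⟶ X) →₀ k at φ
  induction φ using Finsupp.induction_linear with
  | zero => exact Limits.zero_comp
  | add f g hf hg =>
    exact (Preadditive.add_comp (Free.of k E) (Free.of k X) _ f g u).trans
      (congrArg₂ (fun a b : Free.of k E ⟶ Free.of k X => a + b) hf hg)
  | single R r =>
    have : (Finsupp.single R r : Free.of k E ⟶ Free.of k X) = r • lin k R :=
      (Finsupp.smul_single_one R r).symm
    change (Finsupp.single R r : Free.of k E ⟶ Free.of k X) ≫ u = Finsupp.single R r
    rw [this, Linear.smul_comp, hfix R trivial]
    exact this.symm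

end FinCorr

theorem mainTheorem11 (k : Type u) [CommRing k] [IsNoetherianRing k]
    (M : LinCorr.{u, v} k ⥤ ModuleCat.{max u v} k) [M.Additive] [M.Linear k]
    (E : Type v) [Finite E] (hM : LinRep.IsGeneratedAt M (LinCorr.of k E)) :
    (∀ (F : Type v) [Finite F], 2 ^ Nat.card E ≤ Nat.card F →
      IsIso (LinRep.counit M (LinCorr.of k F))) ∧
    (∀ (G : Type v) [Finite G], 2 ^ 2 ^ Nat.card E ≤ Nat.card G →
      Nonempty (M ≅ LinRep.L k (LinCorr.of k G) (M.obj (LinCorr.of k G))) ∧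
      (∀ Y : LinCorr.{u, v} k,
        LinRep.J k (LinCorr.of k G) (M.obj (LinCorr.of k G)) Y = ⊥) ∧
      Nonempty (M ≅ LinRep.S k (LinCorr.of k G) (M.obj (LinCorr.of k G)))) := by
  have units (F : Type v) [Finite F] (hF : 2 ^ Nat.card E ≤ Nat.card F) :
      LinRep.HasLocalUnits k (LinCorr.of k E) (LinCorr.of k F) :=
    FinCorr.hasLocalUnits (E := FinCorr.mk E) (F := FinCorr.mk F) k hF
  refine ⟨fun F _ hF => LinRep.isIso_counit hM (units F hF), fun G _ hG => ?_⟩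
  -- The bound `2 ^ |E|` of part (a) already yields the vanishing of `J`, and the double exponential
  -- exceeds it.
  have hu := units G ((Nat.pow_le_pow_right two_pos Nat.lt_two_pow_self.le).trans hG)
  have := LinRep.isIso_counit hM hu
  have hJ := LinRep.J_eq_bot hM hu
  have iso := (asIso (LinRep.counit M (LinCorr.of k G))).symm
  exact ⟨⟨iso⟩, hJ, ⟨iso ≪≫ LinRep.isoS _ _ hJ⟩⟩
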